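/- Let $\Lambda=\mathbb Z[t,t^{-1}]$. For a finitely generated $\Lambda$-module $M$, let $zM$ be its maximal finite submodule and $\bar M=M/zM$. If $M$ is isomorphic to the cokernel of a homomorphism $\Lambda^r\to\Lambda^s$, $r\ge s$, given by an $r\times s$ matrix $A$ over $\Lambda$, then the order $\Delta(M)$ is the greatest common divisor of the $s\times s$ minors of $A$; it is well defined up to multiplication by units $\pm t^i$ of $\Lambda$. For abelian groups $U,B$ and monomorphisms $f,g\colon U\to B$, the infinite amalgamated sum $$\cdots\oplus_U B\oplus_U B\oplus_U\cdots$$ is the quotient of the direct sum $\bigoplus_{n\in\mathbb Z}B_n$ of copies $B_n=B$ by the subgroup generated by all elements $f(u)_n-g(u)_{n+1}$ with $u\in U$, $n\in\mathbb Z$, where $b_n$ denotes the element $b\in B$ in the $n$-th summand. It is a $\Lambda$-module in which $t$ acts as the shift $b_n\mapsto b_{n+1}$. Corollary. Let $M$ be a finitely generated $\Lambda$-module with $\Delta(M)=c_0+c_1t+\cdots+c_dt^d$ for a representative with $c_i\in\mathbb Z$, $d\ge 0$, $c_0c_d\neq 0$ and $\gcd(c_0,\ldots,c_d)=1$. Then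 there exist monomorphisms $f,g\colon\mathbb Z^d\to\mathbb Z^d$ such that 1. $\bar M$ is isomorphic, as a $\Lambda$-module, to the infinite amalgamated sum $\cdots\oplus_{\mathbb Z^d}\mathbb Z^d\oplus_{\mathbb Z^d}\mathbb Z^d\oplus_{\mathbb Z^d}\cdots$ formed with $f$ and $g$; 2. $\Delta(M)=\det(tg-f)$ up to multiplication by a unit of $\Lambda$; 3. $|c_0|=[\mathbb Z^d:f(\mathbb Z^d)]$ and $|c_d|=[\mathbb Z^d:g(\mathbb Z^d)]$. -/

import Mathlib

open scoped LaurentPolynomial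

noncomputable section

namespace LaurentModule

/-! ### The order of a finitely generated module over the ring of integral Laurent polynomials -/

/-- `A` is a presentation matrix of `M`: the module `M` is isomorphic to the cokernel of the
homomorphism from `Λ^r` to `Λ^s` given by the `r × s` matrix `A` (acting on row vectors). -/
def IsPresentationMatrix (M : Type*) [AddCommGroup M] [Module ℤ[T;T⁻¹] M] {r s : ℕ}
    (A : Matrix (Fin r) (Fin s) ℤ[T;T⁻¹]) : Prop :=
  Nonempty (((Fin s → ℤ[T;T⁻¹]) ⧸ LinearMap.range A.vecMulLinear) ≃ₗ[ℤ[T;T⁻¹]] M)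

/-- `δ` is an order of `M`: it is a greatest common divisor of the `s × s` minors of an `r × s`
presentation matrix of `M` with `s ≤ r`. A minor is obtained by choosing `s` distinct rows; the
ordering of the rows only affects its sign. -/
def IsOrder (M : Type*) [AddCommGroup M] [Module ℤ[T;T⁻¹] M] (δ : ℤ[T;T⁻¹]) : Prop :=
  ∃ (r s : ℕ) (A : Matrix (Fin r) (Fin s) ℤ[T;T⁻¹]), s ≤ r ∧ IsPresentationMatrix M A ∧
    ∀ x : ℤ[T;T⁻¹], x ∣ δ ↔ ∀ ρ : Fin s ↪ Fin r, x ∣ (A.submatrix ρ id).det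

/-! ### The maximal finite submodule -/

/-- The maximal finite submodule `zM` of `M`, as the sum of all finite submodules. -/
def maxFinite (M : Type*) [AddCommGroup M] [Module ℤ[T;T⁻¹] M] : Submodule ℤ[T;T⁻¹] M :=
  sSup {N : Submodule ℤ[T;T⁻¹] M | Finite N}

/-- For a finitely generated module, `zM` is indeed the largest finite submodule. -/
theorem maxFinite_isGreatest (M : Type*) [AddCommGroup M] [Module ℤ[T;T⁻¹] M]
    [Module.Finite ℤ[T;T⁻¹] M] :
    IsGreatest {N : Submodule ℤ[T;T⁻¹] M | Finite N} (maxFinite M) := by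
  refine ⟨?_, fun N hN => le_sSup hN⟩
  have : IsNoetherianRing ℤ[T;T⁻¹] :=
    IsLocalization.isNoetherianRing (Submonoid.powers (Polynomial.X : Polynomial ℤ)) _ inferInstance
  have : IsNoetherian ℤ[T;T⁻¹] M := isNoetherian_of_isNoetherianRing_of_finite _ _
  have hsup : SupClosed {N : Submodule ℤ[T;T⁻¹] M | Finite N} := by
    intro P hP Q hQ
    have hP' : (P : Set M).Finite := hP
    have hQ' : (Q : Set M).Finite := hQ
    have : ((P ⊔ Q : Submodule ℤ[T;T⁻¹] M) : Set M).Finite := by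
      rw [Submodule.coe_sup]
      exact hP'.add hQ'
    exact this
  have hne : {N : Submodule ℤ[T;T⁻¹] M | Finite N}.Nonempty :=
    ⟨⊥, show Finite (⊥ : Submodule ℤ[T;T⁻¹] M) from inferInstance⟩
  exact CompleteLattice.WellFoundedGT.isSupClosedCompact _ inferInstance _ hne hsup

/-! ### The infinite amalgamated sum -/

section Amalgam

variable {U B : Type*} [AddCommGroup U] [AddCommGroup B]

/-- The subgroup of the direct sum of copies `B_n` of `B`, for `n` an integer, that is generated by
the elements `f(u)_n - g(u)_(n+1)`. -/
def amalgamRelators (f g : U →+ B) : AddSubgroup (ℤ →₀ B) :=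
  AddSubgroup.closure
    {x | ∃ (n : ℤ) (u : U), x = Finsupp.single n (f u) - Finsupp.single (n + 1) (g u)}

/-- The infinite amalgamated sum of copies `B_n` of `B`, for `n` an integer: for each `n` the
consecutive factors `B_n` and `B_(n+1)` are amalgamated along `U`, which is mapped to `B_n` by `f`
and to `B_(n+1)` by `g`. -/
def Amalgam (f g : U →+ B) : Type _ := (ℤ →₀ B) ⧸ amalgamRelators f g

instance (f g : U →+ B) : AddCommGroup (Amalgam f g) :=
  inferInstanceAs (AddCommGroup ((ℤ →₀ B) ⧸ amalgamRelators f g))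

/-- The natural map of the `n`-th factor `B_n` to the amalgamated sum. -/
def Amalgam.of (f g : U →+ B) (n : ℤ) (b : B) : Amalgam f g :=
  QuotientAddGroup.mk' (amalgamRelators f g) (Finsupp.single n b)

/-- The shift of the coordinates of the direct sum one place to the right. -/
def shiftSum (B : Type*) [AddCommGroup B] : (ℤ →₀ B) ≃+ (ℤ →₀ B) :=
  Finsupp.domCongr (Equiv.addRight (1 : ℤ))

theorem shiftSum_single (n : ℤ) (b : B) :
    shiftSum B (Finsupp.single n b) = Finsupp.single (n + 1) b := by
  simp [shiftSum]

theorem map_shiftSum_relators (f g : U →+ B) :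
    (amalgamRelators f g).map (shiftSum B : (ℤ →₀ B) →+ (ℤ →₀ B)) = amalgamRelators f g := by
  rw [amalgamRelators, AddMonoidHom.map_closure]
  congr 1
  ext x
  constructor
  · rintro ⟨_, ⟨n, u, rfl⟩, rfl⟩
    exact ⟨n + 1, u, by simp [shiftSum_single]⟩
  · rintro ⟨n, u, rfl⟩
    exact ⟨_, ⟨n - 1, u, rfl⟩, by simp [shiftSum_single]⟩

/-- The automorphism `μ` of the amalgamated sum that shifts the coordinates one place to the
right. -/
def Amalgam.shift (f g : U →+ B) : Amalgam f g ≃+ Amalgam f g :=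
  QuotientAddGroup.congr (amalgamRelators f g) (amalgamRelators f g) (shiftSum B)
    (map_shiftSum_relators f g)

/-- The action of the Laurent polynomials on the amalgamated sum in which `t^n` acts as the `n`-th
power of the shift `μ`. -/
def Amalgam.action (f g : U →+ B) : ℤ[T;T⁻¹] →ₐ[ℤ] Module.End ℤ (Amalgam f g) :=
  AddMonoidAlgebra.lift ℤ (Module.End ℤ (Amalgam f g)) ℤ
    ((LinearEquiv.automorphismGroup.toLinearMapMonoidHom).comp
      (zpowersHom (Amalgam f g ≃ₗ[ℤ] Amalgam f g) (Amalgam.shift f g).toIntLinearEquiv))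

instance (f g : U →+ B) : Module ℤ[T;T⁻¹] (Amalgam f g) :=
  Module.compHom (Amalgam f g) (Amalgam.action f g).toRingHom

theorem Amalgam.T_smul (f g : U →+ B) (x : Amalgam f g) :
    (LaurentPolynomial.T 1 : ℤ[T;T⁻¹]) • x = Amalgam.shift f g x := by
  change AddMonoidAlgebra.lift ℤ (Module.End ℤ (Amalgam f g)) ℤ _
    (AddMonoidAlgebra.single (1 : ℤ) (1 : ℤ)) x = _
  rw [AddMonoidAlgebra.lift_single, one_smul]
  simp [LinearEquiv.automorphismGroup.toLinearMapMonoidHom]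
  rfl

theorem Amalgam.T_smul_of (f g : U →+ B) (n : ℤ) (b : B) :
    (LaurentPolynomial.T 1 : ℤ[T;T⁻¹]) • Amalgam.of f g n b = Amalgam.of f g (n + 1) b := by
  rw [Amalgam.T_smul]
  change QuotientAddGroup.mk' (amalgamRelators f g) (shiftSum B (Finsupp.single n b)) = _
  rw [shiftSum_single]
  rfl

theorem Amalgam.of_eq_of (f g : U →+ B) (n : ℤ) (u : U) :
    Amalgam.of f g n (f u) = Amalgam.of f g (n + 1) (g u) := by
  have h : Finsupp.single n (f u) - Finsupp.single (n + 1) (g u) ∈ amalgamRelators f g :=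
    AddSubgroup.subset_closure ⟨n, u, rfl⟩
  have h' := (QuotientAddGroup.eq_zero_iff _).mpr h
  exact sub_eq_zero.mp h'

end Amalgam

/-- The matrix `tg - f` with entries in the Laurent polynomials, for endomorphisms `f`, `g` of the
lattice of rank `d`, with respect to the standard basis. -/
def pencil {d : ℕ} (f g : (Fin d → ℤ) →+ (Fin d → ℤ)) : Matrix (Fin d) (Fin d) ℤ[T;T⁻¹] :=
  Matrix.of fun i j =>
    LaurentPolynomial.T 1 * LaurentPolynomial.C (g (Pi.single j 1) i) -
      LaurentPolynomial.C (f (Pi.single j 1) i)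

end LaurentModule

end

/-!
Write `Λ` for the ring of integral Laurent polynomials and `N = M / zM`. Since `Δ(M)` is primitive
and the zeroth Fitting ideal of `M` annihilates `M`, for each prime `p` some annihilator of `M` is
not divisible by `p`; it forces an element of order `p` to generate a finite submodule. Hence `N` is
torsion free as a group. Its Fitting ideal contains that of `M` and, up to a power of `|zM|`, is
contained in it, so by primitivity both have the same greatest common divisor.

Let `E` be a finitely generated subgroup of `N` that generates `N` over `Λ`. For large `k` the
groups `P = E + tE + ⋯ + t^(k-1) E` and `Q = P + t^k E` have the same rank, because an annihilator
of `N` moves a multiple of `Q` into `P`, and an element of `Q` lies in `P` as soon as one of its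
translates lies in the sum of the preceding translates of `Q`, because `E` is Noetherian. This
makes `N` the amalgamated sum formed with the maps `x ↦ tx` and `x ↦ x` of `P` to `Q`. In terms of
bases of `P` and `Q` it is presented by `tg - f`, whose determinant is therefore `Δ(M)` up to a
unit of `Λ`, and the extreme coefficients of `det (tg - f)` are `± det f` and `det g`.
-/

noncomputable section

namespace LaurentModule

open Matrix
open Polynomial (toLaurent)

/-! ### The zeroth Fitting ideal -/

section Fitting

variable {R M N ι κ : Type*} [CommRing R] [AddCommGroup M] [Module R M] [AddCommGroup N]
  [Module R N]

theorem span_range_comp_eq_top {f : M →ₗ[R] N} (hf : Function.Surjective f) {x : ι → M}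
    (hx : Submodule.span R (Set.range x) = ⊤) : Submodule.span R (Set.range (f ∘ x)) = ⊤ := by
  rw [Set.range_comp, ← Submodule.map_span, hx, Submodule.map_top, LinearMap.range_eq_top.mpr hf]

variable [Fintype ι] [Fintype κ]

theorem linearCombination_vecMul (x : ι → M) (A : Matrix κ ι R) (v : κ → R) :
    Fintype.linearCombination R x (v ᵥ* A) =
      Fintype.linearCombination R (fun k => Fintype.linearCombination R x (A k)) v := by
  simp only [Fintype.linearCombination_apply, vecMul, dotProduct, Finset.sum_smul,
    Finset.smul_sum, mul_smul]
  exact Finset.sum_comm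

theorem exists_matrix_of_span_le {x : ι → M} {y : κ → M}
    (h : Submodule.span R (Set.range y) ≤ Submodule.span R (Set.range x)) :
    ∃ A : Matrix κ ι R, ∀ v, Fintype.linearCombination R x (v ᵥ* A) =
      Fintype.linearCombination R y v := by
  have hA (k : κ) : ∃ v, Fintype.linearCombination R x v = y k := by
    rw [← LinearMap.mem_range, Fintype.range_linearCombination]
    exact h (Submodule.subset_span ⟨k, rfl⟩)
  choose A hA using hA
  refine ⟨Matrix.of A, fun v => ?_⟩
  rw [linearCombination_vecMul]
  exact congrArg (Fintype.linearCombination R · v) (funext hA)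

theorem exists_generators_of_cokernel_equiv {A : Matrix κ ι R}
    (e : ((ι → R) ⧸ LinearMap.range A.vecMulLinear) ≃ₗ[R] M) :
    ∃ x : ι → M, Submodule.span R (Set.range x) = ⊤ ∧
      ∀ v, Fintype.linearCombination R x v = 0 ↔ ∃ w, w ᵥ* A = v := by
  classical
  let π : (ι → R) →ₗ[R] M := e.toLinearMap ∘ₗ (LinearMap.range A.vecMulLinear).mkQ
  have hπ : Fintype.linearCombination R (fun j => π (Pi.single j 1)) = π := by
    ext j
    simp
  refine ⟨fun j => π (Pi.single j 1), ?_, fun v => ?_⟩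
  · rw [← Fintype.range_linearCombination, hπ, LinearMap.range_eq_top]
    exact e.surjective.comp (Submodule.mkQ_surjective _)
  · rw [hπ]
    change e (Submodule.Quotient.mk v) = 0 ↔ _
    rw [e.map_eq_zero_iff, Submodule.Quotient.mk_eq_zero]
    rfl

variable [DecidableEq ι]

variable (R) in
/-- The ideal generated by the determinants of the square matrices whose rows are linear relations
between the members of the family `x`. It depends only on the submodule generated by `x`; for a
generating family it is the zeroth Fitting ideal. -/
def relationIdeal (x : ι → M) : Ideal R :=
  Ideal.span {a | ∃ V : Matrix ι ι R, (∀ i, Fintype.linearCombination R x (V i) = 0) ∧ V.det = a}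

theorem det_mem_relationIdeal {x : ι → M} {V : Matrix ι ι R}
    (hV : ∀ i, Fintype.linearCombination R x (V i) = 0) : V.det ∈ relationIdeal R x :=
  Ideal.subset_span ⟨V, hV, rfl⟩

theorem relationIdeal_le_iff {x : ι → M} {I : Ideal R} :
    relationIdeal R x ≤ I ↔
      ∀ V : Matrix ι ι R, (∀ i, Fintype.linearCombination R x (V i) = 0) → V.det ∈ I :=
  Ideal.span_le.trans
    ⟨fun h V hV => h ⟨V, hV, rfl⟩, by rintro h _ ⟨V, hV, rfl⟩; exact h V hV⟩

theorem det_mem_relationIdeal_of_injective {x : ι → M} {n : ℕ} (W : Matrix (Fin n) (Fin n) R)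
    {c : ι → Fin n} (hc : Function.Injective c)
    (hW : ∀ i, Fintype.linearCombination R x (fun j => W i (c j)) = 0) :
    W.det ∈ relationIdeal R x := by
  induction n with
  | zero =>
    have : IsEmpty ι := ⟨fun j => (c j).elim0⟩
    rw [W.det_isEmpty, ← (1 : Matrix ι ι R).det_isEmpty]
    exact det_mem_relationIdeal isEmptyElim
  | succ n ih =>
    by_cases hs : Function.Surjective c
    · let e := Equiv.ofBijective c ⟨hc, hs⟩
      rw [← det_submatrix_equiv_self e W]
      exact det_mem_relationIdeal fun i => hW (e i)
    · obtain ⟨k, hk⟩ := not_forall.mp hs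
      choose c' hc' using fun j => Fin.exists_succAbove_eq (y := k) fun h => hk ⟨j, h⟩
      have hinj : Function.Injective c' := fun i j h => hc (by rw [← hc' i, ← hc' j, h])
      rw [det_succ_column W k]
      refine Ideal.sum_mem _ fun i _ => Ideal.mul_mem_left _ _ (ih _ hinj fun l => ?_)
      simpa only [submatrix_apply, hc'] using hW (i.succAbove l)

/-- With `y = A x` and `x = B y`, a matrix `V` of relations on `y` has the same determinant as
`[V, VA; -B, 1 - BA]`, whose columns indexed by `ι` consist of relations on `x`. -/
theorem relationIdeal_le_of_span_eq [DecidableEq κ] {x : ι → M} {y : κ → M}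
    (h : Submodule.span R (Set.range x) = Submodule.span R (Set.range y)) :
    relationIdeal R y ≤ relationIdeal R x := by
  obtain ⟨A, hA⟩ := exists_matrix_of_span_le h.ge
  obtain ⟨B, hB⟩ := exists_matrix_of_span_le h.le
  refine relationIdeal_le_iff.mpr fun V hV => ?_
  let W : Matrix (κ ⊕ ι) (κ ⊕ ι) R := fromBlocks V (V * A) (-B) (1 - B * A)
  have hdet : V.det = W.det := by
    have : W = fromBlocks V 0 (-B) 1 * fromBlocks 1 A 0 1 := by
      simp [W, fromBlocks_multiply, sub_eq_neg_add]
    rw [this, det_mul, det_fromBlocks_zero₁₂, det_fromBlocks_zero₂₁]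
    simp only [det_one, mul_one]
  have hW (i : κ ⊕ ι) : Fintype.linearCombination R x (fun j => W i (Sum.inr j)) = 0 := by
    rcases i with k | j
    · exact (hA (V k)).trans (hV k)
    · have hj : (fun j' => W (Sum.inr j) (Sum.inr j')) =
          Pi.single j 1 - (Pi.single j 1 ᵥ* B) ᵥ* A := by
        ext j'
        rw [single_one_vecMul]
        simp [W, one_eq_pi_single, mul_apply_eq_vecMul, row]
      rw [hj, map_sub, hA, hB, sub_self]
  let e := Fintype.equivFin (κ ⊕ ι)
  rw [hdet, ← det_reindex_self e]
  refine det_mem_relationIdeal_of_injective _ (c := e ∘ Sum.inr)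
    (e.injective.comp Sum.inr_injective) fun i => ?_
  simpa only [reindex_apply, submatrix_apply, Function.comp_apply, Equiv.symm_apply_apply]
    using hW (e.symm i)

theorem relationIdeal_le_relationIdeal_comp (f : M →ₗ[R] N) (x : ι → M) :
    relationIdeal R x ≤ relationIdeal R (f ∘ x) := by
  refine relationIdeal_le_iff.mpr fun V hV => det_mem_relationIdeal fun i => ?_
  have := congrArg f (hV i)
  simpa [Fintype.linearCombination_apply] using this

theorem pow_mul_mem_relationIdeal {f : M →ₗ[R] N} {c : R} (hc : ∀ z ∈ LinearMap.ker f, c • z = 0)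
    (x : ι → M) {a : R} (ha : a ∈ relationIdeal R (f ∘ x)) :
    c ^ Fintype.card ι * a ∈ relationIdeal R x := by
  suffices relationIdeal R (f ∘ x) ≤
      (relationIdeal R x).colon {c ^ Fintype.card ι} from by
    simpa [Submodule.mem_colon_singleton, mul_comm] using this ha
  refine relationIdeal_le_iff.mpr fun V hV => ?_
  rw [Submodule.mem_colon_singleton, smul_eq_mul, mul_comm, ← det_smul]
  refine det_mem_relationIdeal fun i => ?_
  have : Fintype.linearCombination R x ((c • V) i) = c • Fintype.linearCombination R x (V i) :=
    map_smul _ c (V i)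
  rw [this]
  refine hc _ ?_
  rw [LinearMap.mem_ker, ← hV i]
  simp [Fintype.linearCombination_apply]

theorem relationIdeal_le_annihilator (x : ι → M) (hx : Submodule.span R (Set.range x) = ⊤) :
    relationIdeal R x ≤ Module.annihilator R M := by
  refine relationIdeal_le_iff.mpr fun V hV => ?_
  have hker : ∀ v, Fintype.linearCombination R x (vecMul v V) = 0 := fun v => by
    rw [linearCombination_vecMul]
    simp only [hV, Fintype.linearCombination_apply, smul_zero, Finset.sum_const_zero]
  have hdet (j : ι) : V.det • x j = 0 := by
    have := hker (vecMul (Pi.single j 1) V.adjugate)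
    rwa [vecMul_vecMul, adjugate_mul, vecMul_smul, vecMul_one, map_smul,
      Fintype.linearCombination_apply_single, one_smul] at this
  rw [Module.mem_annihilator]
  intro m
  have hm : m ∈ Submodule.span R (Set.range x) := hx ▸ Submodule.mem_top
  induction hm using Submodule.span_induction with
  | mem _ h => obtain ⟨j, rfl⟩ := h; exact hdet j
  | zero => exact smul_zero _
  | add _ _ _ _ h₁ h₂ => rw [smul_add, h₁, h₂, add_zero]
  | smul r _ _ h => rw [smul_comm, h, smul_zero]

variable (R M) in
/-- The zeroth Fitting ideal of a module: the common value of `relationIdeal R x` over the finite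
families `x` generating `M` (and `⊥` when there are none). -/
def fittingIdeal : Ideal R :=
  ⨆ (n : ℕ) (x : Fin n → M) (_ : Submodule.span R (Set.range x) = ⊤), relationIdeal R x

theorem fittingIdeal_eq_relationIdeal (x : ι → M) (hx : Submodule.span R (Set.range x) = ⊤) :
    fittingIdeal R M = relationIdeal R x := by
  refine le_antisymm (iSup_le fun n => iSup₂_le fun y hy => ?_) ?_
  · exact relationIdeal_le_of_span_eq (hx.trans hy.symm)
  · let e := (Fintype.equivFin ι).symm
    have hxe : Submodule.span R (Set.range (x ∘ e)) = ⊤ := by rw [e.surjective.range_comp, hx]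
    exact (relationIdeal_le_of_span_eq (hxe.trans hx.symm)).trans
      (le_iSup_of_le _ (le_iSup₂_of_le (x ∘ e) hxe le_rfl))

theorem fittingIdeal_le_of_surjective {f : M →ₗ[R] N} (hf : Function.Surjective f) :
    fittingIdeal R M ≤ fittingIdeal R N := by
  refine iSup_le fun n => iSup₂_le fun x hx => ?_
  rw [fittingIdeal_eq_relationIdeal _ (span_range_comp_eq_top hf hx)]
  exact relationIdeal_le_relationIdeal_comp f x

theorem fittingIdeal_congr (e : M ≃ₗ[R] N) : fittingIdeal R M = fittingIdeal R N :=
  le_antisymm (fittingIdeal_le_of_surjective (f := e.toLinearMap) e.surjective)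
    (fittingIdeal_le_of_surjective (f := e.symm.toLinearMap) e.symm.surjective)

theorem exists_pow_mul_mem_fittingIdeal [Module.Finite R M] {f : M →ₗ[R] N}
    (hf : Function.Surjective f) {c : R} (hc : ∀ z ∈ LinearMap.ker f, c • z = 0) :
    ∃ s : ℕ, ∀ a ∈ fittingIdeal R N, c ^ s * a ∈ fittingIdeal R M := by
  obtain ⟨n, x, hx⟩ := Module.Finite.exists_fin (R := R) (M := M)
  refine ⟨Fintype.card (Fin n), fun a ha => ?_⟩
  rw [fittingIdeal_eq_relationIdeal _ (span_range_comp_eq_top hf hx)] at ha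
  rw [fittingIdeal_eq_relationIdeal _ hx]
  exact pow_mul_mem_relationIdeal hc x ha

variable (R M) in
theorem fittingIdeal_le_annihilator : fittingIdeal R M ≤ Module.annihilator R M :=
  iSup_le fun _ => iSup₂_le fun x hx => relationIdeal_le_annihilator x hx

theorem det_mul_mem_span_minors (C : Matrix ι κ R) (A : Matrix κ ι R) :
    (C * A).det ∈ Ideal.span (Set.range fun ρ : ι → κ => (A.submatrix ρ id).det) := by
  have hrow : C * A = fun i => ∑ k, C i k • A k := by
    ext i j
    simp [Matrix.mul_apply]
  rw [hrow]
  change (detRowAlternating : (ι → R) [⋀^ι]→ₗ[R] R).toMultilinearMap _ ∈ _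
  rw [MultilinearMap.map_sum]
  refine Ideal.sum_mem _ fun ρ _ => ?_
  rw [MultilinearMap.map_smul_univ]
  exact Ideal.mul_mem_left _ _ (Ideal.subset_span ⟨ρ, rfl⟩)

theorem fittingIdeal_eq_span_minors {A : Matrix κ ι R}
    (e : ((ι → R) ⧸ LinearMap.range A.vecMulLinear) ≃ₗ[R] M) :
    fittingIdeal R M = Ideal.span (Set.range fun ρ : ι → κ => (A.submatrix ρ id).det) := by
  classical
  obtain ⟨x, hx, hA⟩ := exists_generators_of_cokernel_equiv e
  rw [fittingIdeal_eq_relationIdeal x hx]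
  refine le_antisymm (relationIdeal_le_iff.mpr fun V hV => ?_) (Ideal.span_le.mpr ?_)
  · choose C hC using fun i => (hA (V i)).mp (hV i)
    obtain rfl : Matrix.of C * A = V := funext hC
    exact det_mul_mem_span_minors _ A
  · rintro _ ⟨ρ, rfl⟩
    exact det_mem_relationIdeal fun i => (hA _).mpr ⟨Pi.single (ρ i) 1, single_one_vecMul _ _⟩

theorem fittingIdeal_eq_span_det {A : Matrix ι ι R}
    (e : ((ι → R) ⧸ LinearMap.range A.vecMulLinear) ≃ₗ[R] M) :
    fittingIdeal R M = Ideal.span {A.det} := by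
  rw [fittingIdeal_eq_span_minors e]
  refine le_antisymm (Ideal.span_le.mpr ?_) (Ideal.span_mono ?_)
  · rintro _ ⟨ρ, rfl⟩
    have : A.submatrix ρ id = (1 : Matrix ι ι R).submatrix ρ id * A := by
      simpa using submatrix_mul 1 A ρ id id Function.bijective_id
    simp only [this, det_mul]
    exact Ideal.mul_mem_left _ _ (Ideal.mem_span_singleton_self _)
  · rintro _ rfl
    exact ⟨id, rfl⟩

end Fitting

/-! ### Primitive Laurent polynomials -/

section Primitive

variable {R : Type*} [CommRing R]

/-- The analogue of `Polynomial.IsPrimitive`: only units among the constants divide `δ`. -/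
def IsPrimitive (δ : R[T;T⁻¹]) : Prop :=
  ∀ r : R, LaurentPolynomial.C r ∣ δ → IsUnit r

variable [IsDomain R]

theorem toLaurent_dvd_toLaurent_iff {p q : Polynomial R} (hp : p.coeff 0 ≠ 0) :
    toLaurent p ∣ toLaurent q ↔ p ∣ q := by
  refine ⟨fun ⟨a, ha⟩ => ?_, fun h => map_dvd toLaurent h⟩
  obtain ⟨n, r, hr⟩ := a.exists_T_pow
  have hqr : q * Polynomial.X ^ n = p * r := by
    apply Polynomial.toLaurent_injective
    rw [map_mul, map_mul, ha, hr, Polynomial.toLaurent_X_pow, mul_assoc]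
  have hXp : ¬ Polynomial.X ∣ p := by rwa [Polynomial.X_dvd_iff]
  obtain ⟨s, rfl⟩ : Polynomial.X ^ n ∣ r :=
    Polynomial.prime_X.pow_dvd_of_dvd_mul_left n hXp (Dvd.intro_left q hqr)
  exact ⟨s, mul_right_cancel₀ (pow_ne_zero n Polynomial.X_ne_zero) (by rw [hqr]; ring)⟩

theorem C_dvd_toLaurent_iff {r : R} {q : Polynomial R} :
    LaurentPolynomial.C r ∣ toLaurent q ↔ Polynomial.C r ∣ q := by
  rw [← Polynomial.toLaurent_C]
  rcases eq_or_ne r 0 with rfl | hr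
  · simp
  · exact toLaurent_dvd_toLaurent_iff (by rwa [Polynomial.coeff_C_zero])

theorem prime_C {p : R} (hp : Prime p) : Prime (LaurentPolynomial.C p : R[T;T⁻¹]) := by
  have hpC := Polynomial.prime_C_iff.mpr hp
  refine ⟨?_, fun h => ?_, fun a b hab => ?_⟩
  · rw [← Polynomial.toLaurent_C, Polynomial.toLaurent_ne_zero]
    exact hpC.ne_zero
  · have h1 : LaurentPolynomial.C p ∣ toLaurent (1 : Polynomial R) := h.dvd
    exact hpC.not_isUnit (isUnit_of_dvd_one (C_dvd_toLaurent_iff.mp h1))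
  · obtain ⟨m, q, hq⟩ := a.exists_T_pow
    obtain ⟨n, r, hr⟩ := b.exists_T_pow
    have hqr : LaurentPolynomial.C p ∣ toLaurent (q * r) := by
      rw [map_mul, hq, hr, mul_mul_mul_comm]
      exact hab.mul_right _
    rw [← (LaurentPolynomial.isUnit_T m).dvd_mul_right, ← hq, C_dvd_toLaurent_iff,
      ← (LaurentPolynomial.isUnit_T n).dvd_mul_right (b := b), ← hr, C_dvd_toLaurent_iff]
    exact hpC.dvd_or_dvd (C_dvd_toLaurent_iff.mp hqr)

theorem isPrimitive_toLaurent_iff {q : Polynomial R} :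
    IsPrimitive (toLaurent q) ↔ q.IsPrimitive :=
  forall_congr' fun _ => by rw [C_dvd_toLaurent_iff]

theorem IsPrimitive.dvd_of_dvd_C_mul [UniqueFactorizationMonoid R] {δ y : R[T;T⁻¹]}
    (hδ : IsPrimitive δ) {r : R} (hr : r ≠ 0) (h : δ ∣ LaurentPolynomial.C r * y) : δ ∣ y := by
  induction r using UniqueFactorizationMonoid.induction_on_prime with
  | h₁ => exact absurd rfl hr
  | h₂ u hu => exact (hu.map LaurentPolynomial.C).dvd_mul_left.mp h
  | h₃ a p ha hp ih =>
    have hpC := prime_C hp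
    refine ih ha ?_
    obtain ⟨z, hz⟩ := h
    rw [map_mul, mul_assoc] at hz
    obtain ⟨w, rfl⟩ := (hpC.dvd_or_dvd (Dvd.intro _ hz)).resolve_left
      fun hpδ => hp.not_isUnit (hδ p hpδ)
    exact ⟨w, mul_left_cancel₀ hpC.ne_zero (hz.trans (mul_left_comm δ _ w))⟩

end Primitive

section Order

variable {M : Type*} [AddCommGroup M] [Module ℤ[T;T⁻¹] M] {δ : ℤ[T;T⁻¹]}

theorem IsOrder.dvd_iff_fittingIdeal_le (hΔ : IsOrder M δ) {a : ℤ[T;T⁻¹]} :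
    a ∣ δ ↔ fittingIdeal ℤ[T;T⁻¹] M ≤ Ideal.span {a} := by
  obtain ⟨r, s, A, -, ⟨e⟩, hδ⟩ := hΔ
  rw [fittingIdeal_eq_span_minors e, Ideal.span_le, Set.range_subset_iff, hδ]
  simp only [SetLike.mem_coe, Ideal.mem_span_singleton]
  refine ⟨fun h ρ => ?_, fun h ρ => h ρ⟩
  by_cases hρ : Function.Injective ρ
  · exact h ⟨ρ, hρ⟩
  · obtain ⟨i, j, hij, hne⟩ := Function.not_injective_iff.mp hρ
    rw [det_zero_of_row_eq hne (by ext k; simp only [submatrix_apply, hij])]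
    exact dvd_zero a

theorem C_natCard_smul_eq_zero (Z : Submodule ℤ[T;T⁻¹] M) {z : M} (hz : z ∈ Z) :
    (LaurentPolynomial.C (Nat.card Z : ℤ) : ℤ[T;T⁻¹]) • z = 0 := by
  rw [map_natCast, Nat.cast_smul_eq_nsmul]
  exact congrArg Subtype.val (card_nsmul_eq_zero' (x := (⟨z, hz⟩ : Z)))

theorem IsOrder.dvd_iff_fittingIdeal_quotient_le [Module.Finite ℤ[T;T⁻¹] M] (hΔ : IsOrder M δ)
    (hδ : IsPrimitive δ) (Z : Submodule ℤ[T;T⁻¹] M) [Finite Z] {a : ℤ[T;T⁻¹]} :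
    a ∣ δ ↔ fittingIdeal ℤ[T;T⁻¹] (M ⧸ Z) ≤ Ideal.span {a} := by
  refine ⟨fun ha b hb => ?_, fun h => hΔ.dvd_iff_fittingIdeal_le.mpr
    ((fittingIdeal_le_of_surjective Z.mkQ_surjective).trans h)⟩
  obtain ⟨s, hs⟩ := exists_pow_mul_mem_fittingIdeal (c := LaurentPolynomial.C (Nat.card Z : ℤ))
    Z.mkQ_surjective fun z hz => C_natCard_smul_eq_zero Z (Z.ker_mkQ ▸ hz)
  have hδb := hΔ.dvd_iff_fittingIdeal_le.mp dvd_rfl (hs b hb)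
  rw [Ideal.mem_span_singleton, ← map_pow] at hδb
  have hcard : (Nat.card Z : ℤ) ^ s ≠ 0 := pow_ne_zero _ (mod_cast Nat.card_ne_zero.mpr ⟨⟨0⟩, ‹_›⟩)
  exact Ideal.mem_span_singleton.mpr (ha.trans (hδ.dvd_of_dvd_C_mul hcard hδb))

theorem IsOrder.exists_mem_annihilator_not_C_dvd (hΔ : IsOrder M δ) (hδ : IsPrimitive δ)
    {r : ℤ} (hr : ¬ IsUnit r) :
    ∃ a ∈ Module.annihilator ℤ[T;T⁻¹] M, ¬ LaurentPolynomial.C r ∣ a := by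
  have h := mt (fun h => hδ r (hΔ.dvd_iff_fittingIdeal_le.mpr h)) hr
  obtain ⟨a, ha, hra⟩ := SetLike.not_le_iff_exists.mp h
  exact ⟨a, fittingIdeal_le_annihilator _ _ ha, mt Ideal.mem_span_singleton.mpr hra⟩

end Order

/-! ### Torsion in the quotient by the maximal finite submodule -/

section TorsionFree

theorem toLaurent_eq_aeval {R : Type*} [CommRing R] (q : Polynomial R) :
    toLaurent q = Polynomial.aeval (LaurentPolynomial.T 1) q :=
  DFunLike.congr_fun (Polynomial.algHom_ext (f := Polynomial.toLaurentAlg) (by simp)) q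

/-- The images of `T` and `T⁻¹` generate `A` over the field with `p` elements, and the reduction
of `h` modulo `p` shows that both are algebraic. -/
theorem finite_of_surjective {A : Type*} [CommRing A] {p : ℕ} [Fact p.Prime]
    {φ : ℤ[T;T⁻¹] →+* A} (hφ : Function.Surjective φ) (hp : (p : A) = 0) {h : ℤ[T;T⁻¹]}
    (hh : φ h = 0) (hph : ¬ LaurentPolynomial.C (p : ℤ) ∣ h) : Finite A := by
  let _ : Algebra (ZMod p) A := ZMod.algebra' A (ringChar A) (ringChar.dvd hp)
  let t : A := φ (LaurentPolynomial.T 1)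
  let _ : Invertible t := Invertible.map φ _
  have hφt (q : Polynomial ℤ) :
      φ (toLaurent q) = Polynomial.aeval t (q.map (algebraMap ℤ (ZMod p))) := by
    rw [Polynomial.aeval_map_algebraMap, toLaurent_eq_aeval]
    exact (Polynomial.aeval_algHom_apply φ.toIntAlgHom _ q).symm
  have ht : IsAlgebraic (ZMod p) t := by
    obtain ⟨n, q, hq⟩ := h.exists_T_pow
    refine ⟨q.map (algebraMap ℤ (ZMod p)), fun hq0 => hph ?_, ?_⟩
    · rw [← (LaurentPolynomial.isUnit_T n).dvd_mul_right, ← hq, C_dvd_toLaurent_iff,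
        Polynomial.C_dvd_iff_dvd_coeff]
      intro i
      rw [← ZMod.intCast_zmod_eq_zero_iff_dvd, ← eq_intCast (algebraMap ℤ (ZMod p)),
        ← Polynomial.coeff_map, hq0, Polynomial.coeff_zero]
    · rw [← hφt, hq, map_mul, hh, zero_mul]
  have hadjoin : Algebra.adjoin (ZMod p) {t, ⅟t} = ⊤ := by
    refine top_le_iff.mp fun a _ => ?_
    obtain ⟨a, rfl⟩ := hφ a
    induction a using LaurentPolynomial.induction_on_mul_T with
    | mul_T q n =>
      have hinv : φ (LaurentPolynomial.T (-n)) = ⅟t ^ n := by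
        rw [← mul_neg_one, ← LaurentPolynomial.T_pow, map_pow]
        rfl
      rw [map_mul, hφt, hinv]
      exact mul_mem (Algebra.adjoin_mono (by simp) (Polynomial.aeval_mem_adjoin_singleton _ _))
        (pow_mem (Algebra.subset_adjoin (by simp)) n)
  have hfg := fg_adjoin_of_finite (R := ZMod p) (Set.toFinite {t, ⅟t}) (by
    rintro _ (rfl | rfl)
    exacts [ht.isIntegral, ht.invOf.isIntegral])
  rw [hadjoin] at hfg
  have : Module.Finite (ZMod p) A := ⟨hfg⟩
  exact Module.finite_of_finite (ZMod p)

theorem finite_span_singleton {N : Type*} [AddCommGroup N] [Module ℤ[T;T⁻¹] N] {p : ℕ}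
    [Fact p.Prime] {x : N} (hx : p • x = 0) {h : ℤ[T;T⁻¹]} (hh : h • x = 0)
    (hph : ¬ LaurentPolynomial.C (p : ℤ) ∣ h) : Finite (Submodule.span ℤ[T;T⁻¹] {x}) := by
  let I := Ideal.torsionOf ℤ[T;T⁻¹] N x
  have hp : ((p : ℤ[T;T⁻¹] ⧸ I)) = 0 := by
    rw [← map_natCast (Ideal.Quotient.mk I), Ideal.Quotient.eq_zero_iff_mem,
      Ideal.mem_torsionOf_iff, Nat.cast_smul_eq_nsmul, hx]
  have hI : Finite (ℤ[T;T⁻¹] ⧸ I) :=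
    finite_of_surjective Ideal.Quotient.mk_surjective hp (Ideal.Quotient.eq_zero_iff_mem.mpr hh) hph
  exact .of_equiv _ (Ideal.quotTorsionOfEquivSpanSingleton ℤ[T;T⁻¹] N x).toEquiv

theorem finite_comap_mkQ {R M : Type*} [Ring R] [AddCommGroup M] [Module R M]
    (Z : Submodule R M) [Finite Z] (P : Submodule R (M ⧸ Z)) [Finite P] :
    Finite (P.comap Z.mkQ) := by
  let f : P.comap Z.mkQ →+ P := (Z.mkQ.restrict fun _ h => h).toAddMonoidHom
  have hker (x : f.ker) : (x : M) ∈ Z :=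
    (Submodule.Quotient.mk_eq_zero Z).mp (congrArg Subtype.val x.2)
  refine f.finite_iff_finite_ker_range.mpr ⟨?_, inferInstance⟩
  exact .of_injective (fun x => (⟨x, hker x⟩ : Z)) fun x y h =>
    Subtype.ext (Subtype.ext (Subtype.mk.inj h))

variable {M : Type*} [AddCommGroup M] [Module ℤ[T;T⁻¹] M] [Module.Finite ℤ[T;T⁻¹] M]

theorem eq_zero_of_finite_span_singleton {x : M ⧸ maxFinite M}
    [Finite (Submodule.span ℤ[T;T⁻¹] {x})] : x = 0 := by
  have hfin : Finite (maxFinite M) := (maxFinite_isGreatest M).1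
  obtain ⟨y, rfl⟩ := (maxFinite M).mkQ_surjective x
  have hle : (Submodule.span ℤ[T;T⁻¹] {(maxFinite M).mkQ y}).comap (maxFinite M).mkQ ≤
      maxFinite M :=
    (maxFinite_isGreatest M).2 (finite_comap_mkQ _ _)
  exact (Submodule.Quotient.mk_eq_zero _).mpr (hle (Submodule.mem_span_singleton_self _))

theorem isAddTorsionFree_of_prime {G : Type*} [AddCommGroup G]
    (h : ∀ p : ℕ, p.Prime → ∀ x : G, p • x = 0 → x = 0) : IsAddTorsionFree G := by
  rw [isAddTorsionFree_iff_not_isOfFinAddOrder]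
  intro x hx hfin
  obtain ⟨p, hp, hpx⟩ := Nat.exists_prime_and_dvd (mt AddMonoid.addOrderOf_eq_one_iff.mp hx)
  have horder := addOrderOf_nsmul_addOrderOf_sub hfin.addOrderOf_pos.ne' hpx
  have hzero := h p hp _ (addOrderOf_dvd_iff_nsmul_eq_zero.mp horder.dvd)
  rw [hzero, addOrderOf_zero] at horder
  exact hp.ne_one horder.symm

theorem isAddTorsionFree_quotient_maxFinite
    (h : ∀ p : ℕ, p.Prime →
      ∃ a ∈ Module.annihilator ℤ[T;T⁻¹] M, ¬ LaurentPolynomial.C (p : ℤ) ∣ a) :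
    IsAddTorsionFree (M ⧸ maxFinite M) := by
  refine isAddTorsionFree_of_prime fun p hp x hx => ?_
  have := Fact.mk hp
  obtain ⟨a, ha, hpa⟩ := h p hp
  have hax : a • x = 0 :=
    Module.mem_annihilator.mp ((maxFinite M).mkQ.annihilator_le_of_surjective
      (maxFinite M).mkQ_surjective ha) x
  have := finite_span_singleton hx hax hpa
  exact eq_zero_of_finite_span_singleton

end TorsionFree

/-! ### Sums of translates of a submodule -/

section OrbitSpan

variable {R N : Type*} [CommRing R] [AddCommGroup N] [Module R N]

/-- The sum `E + τ E + ⋯ + τ ^ (k - 1) E` of the first `k` translates of `E` under `τ`. -/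
def orbitSpan (τ : Module.End R N) (E : Submodule R N) (k : ℕ) : Submodule R N :=
  ⨆ i < k, E.map (τ ^ i)

variable {τ : Module.End R N} {E : Submodule R N}

theorem orbitSpan_zero : orbitSpan τ E 0 = ⊥ := by
  simp only [orbitSpan, Nat.not_lt_zero, iSup_false, iSup_bot]

theorem orbitSpan_succ (k : ℕ) : orbitSpan τ E (k + 1) = orbitSpan τ E k ⊔ E.map (τ ^ k) :=
  Nat.iSup_lt_succ _ k

theorem orbitSpan_mono : Monotone (orbitSpan τ E) :=
  monotone_nat_of_le_succ fun k => le_sup_left.trans (orbitSpan_succ k).ge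

theorem mem_orbitSpan_succ {k : ℕ} {x : N} :
    x ∈ orbitSpan τ E (k + 1) ↔ ∃ y ∈ orbitSpan τ E k, ∃ z ∈ E, y + (τ ^ k) z = x := by
  simp only [orbitSpan_succ, Submodule.mem_sup, Submodule.mem_map, exists_exists_and_eq_and]

theorem pow_apply_mem_orbitSpan {i k : ℕ} (hik : i < k) {z : N} (hz : z ∈ E) :
    (τ ^ i) z ∈ orbitSpan τ E k :=
  orbitSpan_mono hik (mem_orbitSpan_succ.mpr ⟨0, zero_mem _, z, hz, zero_add _⟩)

theorem le_orbitSpan_succ (k : ℕ) : E ≤ orbitSpan τ E (k + 1) := fun _ hx => by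
  simpa only [pow_zero, Module.End.one_apply] using pow_apply_mem_orbitSpan (τ := τ) k.succ_pos hx

theorem orbitSpan_fg (hE : E.FG) (k : ℕ) : (orbitSpan τ E k).FG := by
  induction k with
  | zero =>
    rw [orbitSpan_zero]
    exact Submodule.fg_bot
  | succ k ih =>
    rw [orbitSpan_succ]
    exact ih.sup (hE.map _)

theorem pow_apply_mem_orbitSpan_add (j : ℕ) {k : ℕ} {x : N} (hx : x ∈ orbitSpan τ E k) :
    (τ ^ j) x ∈ orbitSpan τ E (k + j) := by
  induction k generalizing x with
  | zero =>
    rw [orbitSpan_zero, Submodule.mem_bot] at hx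
    simp only [hx, map_zero, zero_mem]
  | succ k ih =>
    obtain ⟨y, hy, z, hz, rfl⟩ := mem_orbitSpan_succ.mp hx
    rw [map_add, ← Module.End.mul_apply, ← pow_add]
    exact add_mem (orbitSpan_mono (by lia) (ih hy)) (pow_apply_mem_orbitSpan (by lia) hz)

/-- The submodules `{z ∈ E | τ ^ k z ∈ E + ⋯ + τ ^ (k - 1) E}` increase with `k`, hence become
stationary. -/
theorem exists_forall_mem_orbitSpan_of_pow_apply_mem [IsNoetherianRing R] (hE : E.FG) :
    ∃ k₀, ∀ k ≥ k₀, ∀ j, ∀ x ∈ orbitSpan τ E (k + 1), (τ ^ j) x ∈ orbitSpan τ E (k + j) →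
      x ∈ orbitSpan τ E k := by
  have : Module.Finite R E := Module.Finite.iff_fg.mpr hE
  let P : ℕ →o Submodule R E :=
    { toFun := fun k => (orbitSpan τ E k).comap ((τ ^ k).comp E.subtype)
      monotone' := monotone_nat_of_le_succ fun k z hz => by
        have := pow_apply_mem_orbitSpan_add 1 hz
        rwa [LinearMap.comp_apply, ← Module.End.mul_apply, ← pow_add, add_comm 1 k] at this }
  obtain ⟨k₀, hk₀⟩ := monotone_stabilizes_iff_noetherian.mpr inferInstance P
  refine ⟨k₀, fun k hk j x hx hj => ?_⟩
  obtain ⟨y, hy, z, hz, rfl⟩ := mem_orbitSpan_succ.mp hx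
  rw [map_add, (orbitSpan τ E (k + j)).add_mem_iff_right (pow_apply_mem_orbitSpan_add j hy),
    ← Module.End.mul_apply, ← pow_add, add_comm j k] at hj
  have hP : (⟨z, hz⟩ : E) ∈ P (k + j) := hj
  rw [← hk₀ (k + j) (by lia), hk₀ k hk] at hP
  exact add_mem hy hP

theorem leadingCoeff_smul_mem_orbitSpan {q : Polynomial R} (hq : Polynomial.aeval τ q = 0) {k : ℕ}
    (hk : q.natDegree ≤ k) {x : N} (hx : x ∈ orbitSpan τ E (k + 1)) :
    q.leadingCoeff • x ∈ orbitSpan τ E k := by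
  obtain ⟨y, hy, z, hz, rfl⟩ := mem_orbitSpan_succ.mp hx
  obtain ⟨l, rfl⟩ := Nat.exists_eq_add_of_le hk
  have hsum := LinearMap.congr_fun hq ((τ ^ l) z)
  simp only [Polynomial.aeval_eq_sum_range, Finset.sum_range_succ, LinearMap.add_apply,
    LinearMap.sum_apply, LinearMap.smul_apply, LinearMap.zero_apply, ← Module.End.mul_apply,
    ← pow_add] at hsum
  rw [smul_add, Polynomial.leadingCoeff, eq_neg_of_add_eq_zero_right hsum]
  refine add_mem (Submodule.smul_mem _ _ hy) (neg_mem (sum_mem fun i hi => ?_))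
  exact Submodule.smul_mem _ _ (pow_apply_mem_orbitSpan (by have := Finset.mem_range.mp hi; lia) hz)

theorem orbitSpan_orbitSpan_succ_le (j k : ℕ) :
    orbitSpan τ (orbitSpan τ E j) (k + 1) ≤ orbitSpan τ E (j + k) :=
  iSup₂_le fun i hi => Submodule.map_le_iff_le_comap.mpr fun _ hx =>
    orbitSpan_mono (by lia) (pow_apply_mem_orbitSpan_add i hx)

theorem map_orbitSpan {N' : Type*} [AddCommGroup N'] [Module R N'] {τ' : Module.End R N'}
    {φ : N →ₗ[R] N'} (hφ : τ' ∘ₗ φ = φ ∘ₗ τ) (k : ℕ) :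
    (orbitSpan τ E k).map φ = orbitSpan τ' (E.map φ) k := by
  simp only [orbitSpan, Submodule.map_iSup, ← Submodule.map_comp,
    Module.End.commute_pow_left_of_commute hφ]

end OrbitSpan

/-! ### Decompositions as amalgamated sums -/

section Decomposition

variable {N : Type*} [AddCommGroup N] [Module ℤ[T;T⁻¹] N]

variable (N) in
/-- Multiplication by `t`, as an endomorphism of the underlying abelian group. -/
abbrev mulT : Module.End ℤ N :=
  Algebra.lsmul ℤ ℤ N (LaurentPolynomial.T 1 : ℤ[T;T⁻¹])

theorem mulT_pow_apply (k : ℕ) (x : N) :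
    (mulT N ^ k) x = (LaurentPolynomial.T k : ℤ[T;T⁻¹]) • x := by
  rw [mulT, ← map_pow, LaurentPolynomial.T_pow, mul_one, Algebra.lsmul_coe]

theorem aeval_mulT_apply (q : Polynomial ℤ) (x : N) :
    Polynomial.aeval (mulT N) q x = toLaurent q • x := by
  rw [mulT, Polynomial.aeval_algHom_apply, ← toLaurent_eq_aeval, Algebra.lsmul_coe]

variable {U B U' B' : Type*} [AddCommGroup U] [AddCommGroup B] [AddCommGroup U'] [AddCommGroup B']

/-- The embedding `β` of `B` in `N` exhibits `N` as the infinite amalgamated sum formed with `f`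
and `g`: the translates of `B` generate `N`, the identification of `f u` with `t g(u)` holds in `N`,
and a translate of `B` meets the sum of finitely many preceding ones in a translate of `g(U)`. -/
structure IsAmalgamDecomposition (f g : U →+ B) (β : B →ₗ[ℤ] N) : Prop where
  injective : Function.Injective β
  injective_right : Function.Injective g
  apply_eq (u : U) : β (f u) = mulT N (β (g u))
  span_range : Submodule.span ℤ[T;T⁻¹] (Set.range β) = ⊤
  mem_range (m : ℕ) (y : B)
    (hy : (mulT N ^ (m + 1)) (β y) ∈ orbitSpan (mulT N) (LinearMap.range β) (m + 1)) : y ∈ g.range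

namespace IsAmalgamDecomposition

theorem injective_left {f g : U →+ B} {β : B →ₗ[ℤ] N} (h : IsAmalgamDecomposition f g β) :
    Function.Injective f := fun u v huv => by
  have hβ := congrArg β huv
  rw [h.apply_eq, h.apply_eq] at hβ
  exact h.injective_right (h.injective ((LaurentPolynomial.isUnit_T 1).smul_left_cancel.mp hβ))

theorem congr {f g : U →+ B} {β : B →ₗ[ℤ] N} (h : IsAmalgamDecomposition f g β)
    (a : U' ≃+ U) (b : B' ≃ₗ[ℤ] B) :
    IsAmalgamDecomposition ((b.symm : B →+ B').comp (f.comp (a : U' →+ U)))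
      ((b.symm : B →+ B').comp (g.comp (a : U' →+ U))) (β ∘ₗ (b : B' →ₗ[ℤ] B)) where
  injective := h.injective.comp b.injective
  injective_right := b.symm.injective.comp (h.injective_right.comp a.injective)
  apply_eq u := by simpa using h.apply_eq (a u)
  span_range := by
    rw [LinearMap.coe_comp, LinearEquiv.coe_coe, b.surjective.range_comp, h.span_range]
  mem_range m y hy := by
    rw [LinearMap.range_comp_of_range_eq_top _ b.range] at hy
    obtain ⟨u, hu⟩ := h.mem_range m (b y) hy
    exact ⟨a.symm u, by simp [hu]⟩

end IsAmalgamDecomposition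

theorem isAmalgamDecomposition_subtype {P Q : Submodule ℤ N} (hPQ : P ≤ Q)
    (hT : ∀ x ∈ P, mulT N x ∈ Q) (hspan : Submodule.span ℤ[T;T⁻¹] (Q : Set N) = ⊤)
    (hP : ∀ (m : ℕ), ∀ y ∈ Q, (mulT N ^ (m + 1)) y ∈ orbitSpan (mulT N) Q (m + 1) → y ∈ P) :
    IsAmalgamDecomposition ((mulT N).restrict hT).toAddMonoidHom
      (Submodule.inclusion hPQ).toAddMonoidHom Q.subtype where
  injective := Q.subtype_injective
  injective_right := Submodule.inclusion_injective hPQ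
  apply_eq _ := rfl
  span_range := by rw [Submodule.coe_subtype, Subtype.range_coe, hspan]
  mem_range m y hy := by
    rw [Q.range_subtype] at hy
    exact ⟨⟨y, hP m y y.2 hy⟩, rfl⟩

theorem rank_eq_of_smul_mem {R : Type*} {V : Type*} [CommRing R] [IsDomain R] [AddCommGroup V]
    [Module R V] [Module.IsTorsionFree R V] {P Q : Submodule R V} (hPQ : P ≤ Q) {a : R}
    (ha : a ≠ 0) (h : ∀ x ∈ Q, a • x ∈ P) : Module.rank R P = Module.rank R Q :=
  (LinearMap.rank_le_of_injective _ (Submodule.inclusion_injective hPQ)).antisymm <|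
    LinearMap.rank_le_of_injective ((LinearMap.lsmul R V a).restrict h) fun _ _ hxy =>
      Subtype.ext (smul_right_injective V ha (Subtype.mk.inj hxy))

theorem exists_isAmalgamDecomposition [Module.Finite ℤ[T;T⁻¹] N] [IsAddTorsionFree N]
    {a : ℤ[T;T⁻¹]} (ha0 : a ≠ 0) (ha : a ∈ Module.annihilator ℤ[T;T⁻¹] N) :
    ∃ (e : ℕ) (f g : (Fin e → ℤ) →+ (Fin e → ℤ)) (β : (Fin e → ℤ) →ₗ[ℤ] N),
      IsAmalgamDecomposition f g β := by
  obtain ⟨s, hs⟩ := Module.finite_def.mp ‹Module.Finite ℤ[T;T⁻¹] N›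
  let E : Submodule ℤ N := Submodule.span ℤ (s : Set N)
  have hE : Submodule.span ℤ[T;T⁻¹] (E : Set N) = ⊤ :=
    eq_top_iff.mpr (hs ▸ Submodule.span_mono Submodule.subset_span)
  obtain ⟨n, q, hq⟩ := a.exists_T_pow
  have hq0 : q.leadingCoeff ≠ 0 := by
    rw [Polynomial.leadingCoeff_ne_zero, ← Polynomial.toLaurent_ne_zero, hq]
    exact mul_ne_zero ha0 (LaurentPolynomial.isUnit_T _).ne_zero
  have hqN : Polynomial.aeval (mulT N) q = 0 := LinearMap.ext fun x => by
    rw [aeval_mulT_apply, hq]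
    exact Module.mem_annihilator.mp (Ideal.mul_mem_right _ _ ha) x
  obtain ⟨k₀, hk₀⟩ := exists_forall_mem_orbitSpan_of_pow_apply_mem (τ := mulT N) (E := E) ⟨s, rfl⟩
  let k := max k₀ q.natDegree
  have hrank : Module.finrank ℤ (orbitSpan (mulT N) E k) =
      Module.finrank ℤ (orbitSpan (mulT N) E (k + 1)) :=
    congrArg Cardinal.toNat (rank_eq_of_smul_mem (orbitSpan_mono k.le_succ) hq0 fun x hx =>
      leadingCoeff_smul_mem_orbitSpan hqN (le_max_right _ _) hx)
  have hfin (j : ℕ) : Module.Finite ℤ (orbitSpan (mulT N) E j) :=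
    Module.Finite.iff_fg.mpr (orbitSpan_fg ⟨s, rfl⟩ j)
  have hdecomp := (isAmalgamDecomposition_subtype (orbitSpan_mono k.le_succ)
    (fun x hx => by simpa only [pow_one] using pow_apply_mem_orbitSpan_add 1 hx)
    (eq_top_iff.mpr (hE ▸ Submodule.span_mono (le_orbitSpan_succ k)))
    (fun m y hy hmy => hk₀ k (le_max_left _ _) (m + 1) y hy <|
      orbitSpan_mono (by lia) (orbitSpan_orbitSpan_succ_le (k + 1) m hmy))).congr
    (Module.finBasisOfFinrankEq ℤ _ hrank).equivFun.symm.toAddEquiv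
    (Module.finBasis ℤ _).equivFun.symm
  exact ⟨_, _, _, _, hdecomp⟩

end Decomposition

section AmalgamMaps

variable {A N : Type*} [AddCommGroup A] [Module ℤ[T;T⁻¹] A] [AddCommGroup N] [Module ℤ[T;T⁻¹] N]

theorem C_smul (r : ℤ) (x : N) : (LaurentPolynomial.C r : ℤ[T;T⁻¹]) • x = r • x :=
  algebraMap_smul ℤ[T;T⁻¹] r x

theorem map_smul_of_map_T_smul (φ : A →+ N)
    (hφ : ∀ x, φ ((LaurentPolynomial.T 1 : ℤ[T;T⁻¹]) • x) =
      (LaurentPolynomial.T 1 : ℤ[T;T⁻¹]) • φ x) (a : ℤ[T;T⁻¹]) (x : A) :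
    φ (a • x) = a • φ x := by
  induction a using LaurentPolynomial.induction_on generalizing x with
  | h_C r => rw [C_smul, C_smul, map_zsmul]
  | h_add hp hq => rw [add_smul, map_add, hp, hq, add_smul]
  | h_C_mul_T n r ih =>
    rw [LaurentPolynomial.T_add, ← mul_assoc, mul_smul, ih, hφ, mul_smul _ (LaurentPolynomial.T 1)]
  | h_C_mul_T_Z n r ih =>
    rw [← (LaurentPolynomial.isUnit_T (R := ℤ) 1).smul_left_cancel, ← hφ]
    simp only [smul_smul, mul_left_comm (LaurentPolynomial.T 1), ← LaurentPolynomial.T_add,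
      add_sub_cancel, ih]

namespace Amalgam

variable {U B : Type*} [AddCommGroup U] [AddCommGroup B] {f g : U →+ B}

theorem induction_on {P : Amalgam f g → Prop} (x : Amalgam f g) (of : ∀ n b, P (of f g n b))
    (add : ∀ x y, P x → P y → P (x + y)) : P x := by
  obtain ⟨w, rfl⟩ := QuotientAddGroup.mk'_surjective _ x
  induction w using Finsupp.induction_linear with
  | zero => simpa only [Amalgam.of, Finsupp.single_zero] using of 0 0
  | add v w hv hw => exact map_add (QuotientAddGroup.mk' (amalgamRelators f g)) v w ▸ add _ _ hv hw
  | single n b => exact of n b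

variable (f g) in
/-- The embedding of the factor of index zero. -/
def ofZero : B →ₗ[ℤ] Amalgam f g :=
  ((QuotientAddGroup.mk' (amalgamRelators f g)).comp
    (Finsupp.singleAddHom 0)).toIntLinearMap

theorem T_smul_of_eq (m n : ℤ) (b : B) :
    (LaurentPolynomial.T m : ℤ[T;T⁻¹]) • of f g n b = of f g (m + n) b := by
  induction m using Int.induction_on with
  | zero => rw [LaurentPolynomial.T_zero, one_smul, zero_add]
  | succ i ih =>
    rw [add_comm (i : ℤ), LaurentPolynomial.T_add, mul_smul, ih, T_smul_of]
    congr 1; ring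
  | pred i ih =>
    rw [← (LaurentPolynomial.isUnit_T (R := ℤ) 1).smul_left_cancel, smul_smul,
      ← LaurentPolynomial.T_add, add_sub_cancel, ih, T_smul_of]
    congr 1; ring

theorem of_eq_T_smul (n : ℤ) (b : B) :
    of f g n b = (LaurentPolynomial.T n : ℤ[T;T⁻¹]) • ofZero f g b := by
  rw [← add_zero n, ← T_smul_of_eq, add_zero]
  rfl

theorem ofZero_left (u : U) : ofZero f g (f u) = mulT _ (ofZero f g (g u)) :=
  (of_eq_of f g 0 u).trans (T_smul_of f g 0 (g u)).symm

theorem hom_ext {φ ψ : Amalgam f g →ₗ[ℤ[T;T⁻¹]] N} (h : ∀ b, φ (ofZero f g b) = ψ (ofZero f g b)) :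
    φ = ψ := by
  ext x
  induction x using induction_on with
  | of n b => rw [of_eq_T_smul, map_smul, map_smul, h]
  | add x y hx hy => rw [map_add, map_add, hx, hy]

variable (β : B →ₗ[ℤ] N)

theorem amalgamRelators_le_ker (hβ : ∀ u, β (f u) = mulT N (β (g u))) :
    amalgamRelators f g ≤ (Finsupp.liftAddHom fun n : ℤ =>
      (DistribSMul.toAddMonoidHom N (LaurentPolynomial.T n : ℤ[T;T⁻¹])).comp
        β.toAddMonoidHom).ker := by
  refine (AddSubgroup.closure_le _).mpr ?_
  rintro _ ⟨n, u, rfl⟩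
  rw [SetLike.mem_coe, AddMonoidHom.mem_ker, map_sub, Finsupp.liftAddHom_apply_single,
    Finsupp.liftAddHom_apply_single, LaurentPolynomial.T_add]
  exact sub_eq_zero.mpr (congrArg _ (hβ u) |>.trans (mul_smul _ _ _).symm)

/-- The universal property of the amalgamated sum. -/
def lift (hβ : ∀ u, β (f u) = mulT N (β (g u))) : Amalgam f g →ₗ[ℤ[T;T⁻¹]] N :=
  let φ : Amalgam f g →+ N := QuotientAddGroup.lift _ _ (amalgamRelators_le_ker β hβ)
  have hφ (n : ℤ) (b : B) : φ (of f g n b) = (LaurentPolynomial.T n : ℤ[T;T⁻¹]) • β b :=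
    Finsupp.liftAddHom_apply_single _ n b
  { φ with
    map_smul' := map_smul_of_map_T_smul φ fun x => by
      induction x using induction_on with
      | of n b => rw [T_smul_of, hφ, hφ, add_comm, LaurentPolynomial.T_add, mul_smul]
      | add x y hx hy => rw [smul_add, map_add, map_add, smul_add, hx, hy] }

theorem lift_ofZero (hβ : ∀ u, β (f u) = mulT N (β (g u))) (b : B) :
    lift β hβ (ofZero f g b) = β b :=
  (Finsupp.liftAddHom_apply_single _ 0 b).trans (by simp)

theorem lift_mem_orbitSpan (hβ : ∀ u, β (f u) = mulT N (β (g u))) {m : ℕ} {x : Amalgam f g}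
    (hx : x ∈ orbitSpan (mulT _) (LinearMap.range (ofZero f g)) m) :
    lift β hβ x ∈ orbitSpan (mulT N) (LinearMap.range β) m := by
  let φ : Amalgam f g →ₗ[ℤ] N := (lift β hβ).restrictScalars ℤ
  have hφ : φ ∘ₗ ofZero f g = β := LinearMap.ext (lift_ofZero β hβ)
  have hT : mulT N ∘ₗ φ = φ ∘ₗ mulT _ := LinearMap.ext fun x => ((lift β hβ).map_smul _ x).symm
  have hrange : (LinearMap.range (ofZero f g)).map φ = LinearMap.range β := by
    rw [← LinearMap.range_comp, hφ]
  exact hrange ▸ map_orbitSpan hT m ▸ Submodule.mem_map_of_mem hx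

theorem exists_T_smul_mem_orbitSpan (x : Amalgam f g) :
    ∃ n m : ℕ, (mulT _ ^ n) x ∈ orbitSpan (mulT _) (LinearMap.range (ofZero f g)) m := by
  induction x using induction_on with
  | of k b =>
    refine ⟨(-k).toNat, k.toNat + 1, ?_⟩
    have : (mulT _ ^ (-k).toNat) (of f g k b) = (mulT _ ^ k.toNat) (ofZero f g b) := by
      rw [mulT_pow_apply, mulT_pow_apply, T_smul_of_eq, of_eq_T_smul]
      congr 2; lia
    exact this ▸ pow_apply_mem_orbitSpan k.toNat.lt_succ_self ⟨b, rfl⟩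
  | add x y hx hy =>
    obtain ⟨n, m, hx⟩ := hx
    obtain ⟨n', m', hy⟩ := hy
    refine ⟨n + n', max (m + n') (m' + n), ?_⟩
    rw [map_add]
    refine add_mem ?_ ?_
    · rw [add_comm n, pow_add]
      exact orbitSpan_mono (le_max_left _ _) (pow_apply_mem_orbitSpan_add n' hx)
    · rw [pow_add]
      exact orbitSpan_mono (le_max_right _ _) (pow_apply_mem_orbitSpan_add n hy)

end Amalgam

namespace IsAmalgamDecomposition

variable {U B : Type*} [AddCommGroup U] [AddCommGroup B] {f g : U →+ B} {β : B →ₗ[ℤ] N}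

/-- The leading coefficient of a relation lies in `g(U)`, so that it can be moved one place to the
left without changing the element of the amalgamated sum. -/
theorem eq_zero_of_mem_orbitSpan (h : IsAmalgamDecomposition f g β) {m : ℕ} {x : Amalgam f g}
    (hx : x ∈ orbitSpan (mulT _) (LinearMap.range (Amalgam.ofZero f g)) m)
    (hx0 : Amalgam.lift β h.apply_eq x = 0) : x = 0 := by
  induction m generalizing x with
  | zero => rwa [orbitSpan_zero] at hx
  | succ m ih =>
    obtain ⟨y, hy, _, ⟨b, rfl⟩, rfl⟩ := mem_orbitSpan_succ.mp hx
    have hb : (mulT N ^ m) (β b) ∈ orbitSpan (mulT N) (LinearMap.range β) m := by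
      rw [map_add, mulT_pow_apply, map_smul, Amalgam.lift_ofZero, ← mulT_pow_apply] at hx0
      rw [eq_neg_of_add_eq_zero_right hx0]
      exact neg_mem (Amalgam.lift_mem_orbitSpan β h.apply_eq hy)
    refine ih ?_ hx0
    refine add_mem hy ?_
    cases m with
    | zero =>
      rw [orbitSpan_zero, Submodule.mem_bot, pow_zero, Module.End.one_apply] at hb
      rw [h.injective (hb.trans (map_zero β).symm), map_zero, map_zero]
      exact zero_mem _
    | succ m =>
      obtain ⟨u, rfl⟩ := h.mem_range m b hb
      rw [pow_succ, Module.End.mul_apply, ← Amalgam.ofZero_left]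
      exact pow_apply_mem_orbitSpan m.lt_succ_self ⟨f u, rfl⟩

theorem lift_bijective (h : IsAmalgamDecomposition f g β) :
    Function.Bijective (Amalgam.lift β h.apply_eq) := by
  constructor
  · refine (injective_iff_map_eq_zero _).mpr fun x hx => ?_
    obtain ⟨n, m, hm⟩ := Amalgam.exists_T_smul_mem_orbitSpan x
    rw [mulT_pow_apply] at hm
    rw [← (LaurentPolynomial.isUnit_T (R := ℤ) n).smul_eq_zero]
    exact h.eq_zero_of_mem_orbitSpan hm (by rw [map_smul, hx, smul_zero])
  · rw [← LinearMap.range_eq_top, eq_top_iff, ← h.span_range, Submodule.span_le]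
    rintro _ ⟨b, rfl⟩
    exact ⟨_, Amalgam.lift_ofZero β h.apply_eq b⟩

end IsAmalgamDecomposition

end AmalgamMaps

/-! ### The pencil of an amalgamated sum -/

section Pencil

variable {d : ℕ} (f g : (Fin d → ℤ) →+ (Fin d → ℤ))

/-- The matrix of an endomorphism of the lattice of rank `d` in the standard basis. -/
def latticeMatrix : Matrix (Fin d) (Fin d) ℤ :=
  LinearMap.toMatrix' f.toIntLinearMap

theorem pencil_eq : pencil f g =
    (LaurentPolynomial.T 1 : ℤ[T;T⁻¹]) • (latticeMatrix g).map LaurentPolynomial.C -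
      (latticeMatrix f).map LaurentPolynomial.C := by
  ext1 i j
  simp [pencil, latticeMatrix, LinearMap.toMatrix'_apply]

theorem pencil_mulVec_C (u : Fin d → ℤ) : pencil f g *ᵥ (LaurentPolynomial.C ∘ u) =
    (LaurentPolynomial.T 1 : ℤ[T;T⁻¹]) • (LaurentPolynomial.C ∘ g u) -
      LaurentPolynomial.C ∘ f u := by
  have hmap (h : (Fin d → ℤ) →+ (Fin d → ℤ)) :
      (latticeMatrix h).map LaurentPolynomial.C *ᵥ (LaurentPolynomial.C ∘ u) =
        (LaurentPolynomial.C ∘ h u : Fin d → ℤ[T;T⁻¹]) := by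
    ext1 i
    rw [← RingHom.map_mulVec, latticeMatrix, LinearMap.toMatrix'_mulVec]
    rfl
  rw [pencil_eq, sub_mulVec, smul_mulVec, hmap, hmap]

theorem linearCombination_C_comp {N : Type*} [AddCommGroup N] [Module ℤ[T;T⁻¹] N]
    (β : (Fin d → ℤ) →ₗ[ℤ] N) (u : Fin d → ℤ) :
    Fintype.linearCombination ℤ[T;T⁻¹] (fun j => β (Pi.single j 1)) (LaurentPolynomial.C ∘ u) =
      β u := by
  rw [Fintype.linearCombination_apply, LinearMap.pi_apply_eq_sum_univ β u]
  exact Finset.sum_congr rfl fun j _ => (C_smul _ _).trans (congrArg _ (congrArg β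
    (funext fun i => by simp [Pi.single_apply, eq_comm])))

theorem C_comp_single (j : Fin d) :
    (LaurentPolynomial.C ∘ Pi.single j (1 : ℤ) : Fin d → ℤ[T;T⁻¹]) = Pi.single j 1 := by
  ext1 i
  rcases eq_or_ne i j with rfl | hij
  · simp
  · simp [hij]

/-- Both sides are generated by the factor of index zero, subject to `f u = t g(u)`. -/
theorem isPresentationMatrix_pencil :
    IsPresentationMatrix (Amalgam f g) (pencil f g)ᵀ := by
  let K := LinearMap.range (pencil f g)ᵀ.vecMulLinear
  let κ : (Fin d → ℤ) →ₗ[ℤ] (Fin d → ℤ[T;T⁻¹]) ⧸ K :=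
    (K.mkQ.restrictScalars ℤ).comp (LinearMap.compLeft (Algebra.linearMap ℤ ℤ[T;T⁻¹]) (Fin d))
  have hκ (u : Fin d → ℤ) : κ (f u) = mulT _ (κ (g u)) := by
    refine ((Submodule.Quotient.eq K).mpr ⟨LaurentPolynomial.C ∘ u, ?_⟩).symm
    rw [vecMulLinear_apply, vecMul_transpose]
    exact pencil_mulVec_C f g u
  let φ : (Fin d → ℤ[T;T⁻¹]) →ₗ[ℤ[T;T⁻¹]] Amalgam f g :=
    Fintype.linearCombination ℤ[T;T⁻¹] fun j => Amalgam.ofZero f g (Pi.single j 1)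
  have hφ (u : Fin d → ℤ) : φ (LaurentPolynomial.C ∘ u) = Amalgam.ofZero f g u :=
    linearCombination_C_comp (Amalgam.ofZero f g) u
  have hφK : φ ∘ₗ (pencil f g)ᵀ.vecMulLinear = 0 := by
    refine LinearMap.pi_ext' fun j => LinearMap.ext_ring ?_
    change φ (Pi.single j 1 ᵥ* (pencil f g)ᵀ) = 0
    rw [vecMul_transpose, ← C_comp_single, pencil_mulVec_C, map_sub, map_smul, hφ, hφ,
      Amalgam.ofZero_left]
    exact sub_self _
  have hK : K ≤ LinearMap.ker φ := LinearMap.range_le_ker_iff.mpr hφK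
  refine ⟨LinearEquiv.ofLinearMap (K.liftQ φ hK) (Amalgam.lift κ hκ) ?_ ?_⟩
  · refine Amalgam.hom_ext fun b => ?_
    rw [LinearMap.comp_apply, Amalgam.lift_ofZero]
    exact hφ b
  · refine Submodule.linearMap_qext _ (LinearMap.pi_ext' fun j => LinearMap.ext_ring ?_)
    change Amalgam.lift κ hκ (φ (Pi.single j 1)) = K.mkQ (Pi.single j 1)
    rw [← C_comp_single, hφ, Amalgam.lift_ofZero]
    rfl

end Pencil

section PencilPolynomial

variable {d : ℕ} {f g : (Fin d → ℤ) →+ (Fin d → ℤ)}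

theorem index_range_eq_natAbs_det (hf : Function.Injective f) :
    f.range.index = (latticeMatrix f).det.natAbs := by
  rw [latticeMatrix, LinearMap.det_toMatrix']
  exact (Submodule.natAbs_det_equiv (LinearMap.range f.toIntLinearMap)
    (LinearEquiv.ofInjective f.toIntLinearMap hf)).symm

theorem det_latticeMatrix_ne_zero (hf : Function.Injective f) : (latticeMatrix f).det ≠ 0 := by
  intro hdet
  obtain ⟨v, hv, hfv⟩ := exists_mulVec_eq_zero_iff.mpr hdet
  rw [latticeMatrix, LinearMap.toMatrix'_mulVec] at hfv
  exact hv (hf (hfv.trans (map_zero f).symm))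

variable (f g) in
/-- The determinant of the pencil `tg - f` as a polynomial in `t`. -/
def pencilPolynomial : Polynomial ℤ :=
  ((Polynomial.X : Polynomial ℤ) • (latticeMatrix g).map Polynomial.C +
    (-latticeMatrix f).map Polynomial.C).det

theorem toLaurent_pencilPolynomial : toLaurent (pencilPolynomial f g) = (pencil f g).det := by
  rw [pencilPolynomial, RingHom.map_det, pencil_eq]
  congr 1
  ext1 i j
  simp [sub_eq_add_neg]

theorem coeff_zero_pencilPolynomial :
    (pencilPolynomial f g).coeff 0 = (-1) ^ d * (latticeMatrix f).det := by
  rw [pencilPolynomial, Polynomial.coeff_det_X_add_C_zero, det_neg, Fintype.card_fin]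

theorem coeff_pencilPolynomial : (pencilPolynomial f g).coeff d = (latticeMatrix g).det := by
  simpa only [Fintype.card_fin, pencilPolynomial] using
    Polynomial.coeff_det_X_add_C_card (latticeMatrix g) (-latticeMatrix f)

theorem natAbs_coeff_zero_pencilPolynomial (hf : Function.Injective f) :
    ((pencilPolynomial f g).coeff 0).natAbs = f.range.index := by
  simp [coeff_zero_pencilPolynomial, index_range_eq_natAbs_det hf, Int.natAbs_mul]

theorem natAbs_coeff_pencilPolynomial (hg : Function.Injective g) :
    ((pencilPolynomial f g).coeff d).natAbs = g.range.index := by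
  rw [coeff_pencilPolynomial, index_range_eq_natAbs_det hg]

theorem coeff_zero_pencilPolynomial_ne_zero (hf : Function.Injective f) :
    (pencilPolynomial f g).coeff 0 ≠ 0 := by
  rw [coeff_zero_pencilPolynomial]
  exact mul_ne_zero (pow_ne_zero _ (by norm_num)) (det_latticeMatrix_ne_zero hf)

theorem natDegree_pencilPolynomial (hg : Function.Injective g) :
    (pencilPolynomial f g).natDegree = d := by
  refine le_antisymm ?_ (Polynomial.le_natDegree_of_ne_zero ?_)
  · simpa only [Fintype.card_fin, pencilPolynomial] using
      Polynomial.natDegree_det_X_add_C_le (latticeMatrix g) (-latticeMatrix f)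
  · rw [coeff_pencilPolynomial]
    exact det_latticeMatrix_ne_zero hg

end PencilPolynomial

section Coefficients

theorem associated_of_associated_toLaurent {R : Type*} [CommRing R] [IsDomain R]
    {p q : Polynomial R} (hp : p.coeff 0 ≠ 0) (hq : q.coeff 0 ≠ 0)
    (h : Associated (toLaurent p) (toLaurent q)) : Associated p q :=
  associated_of_dvd_dvd ((toLaurent_dvd_toLaurent_iff hp).mp h.dvd)
    ((toLaurent_dvd_toLaurent_iff hq).mp h.symm.dvd)

theorem natAbs_coeff_eq_of_associated {p q : Polynomial ℤ} (h : Associated p q) (k : ℕ) :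
    (p.coeff k).natAbs = (q.coeff k).natAbs := by
  obtain ⟨u, rfl⟩ := h
  obtain ⟨c, hc, hcu⟩ := Polynomial.isUnit_iff.mp u.isUnit
  rw [← hcu, Polynomial.coeff_mul_C, Int.natAbs_mul, Int.isUnit_iff_natAbs_eq.mp hc, mul_one]

variable {R : Type*} [CommRing R] {d : ℕ} (c : Fin (d + 1) → R)

/-- The polynomial with coefficients `c 0, …, c d`. -/
def ofCoeffs : Polynomial R :=
  ∑ i : Fin (d + 1), Polynomial.C (c i) * Polynomial.X ^ (i : ℕ)

theorem toLaurent_ofCoeffs : toLaurent (ofCoeffs c) =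
    ∑ i : Fin (d + 1), LaurentPolynomial.C (c i) * LaurentPolynomial.T ((i : ℕ) : ℤ) := by
  simp [ofCoeffs]

theorem coeff_ofCoeffs (i : Fin (d + 1)) : (ofCoeffs c).coeff i = c i := by
  simp [ofCoeffs, Polynomial.finsetSum_coeff, Polynomial.coeff_X_pow, Fin.val_inj]

theorem coeff_zero_ofCoeffs : (ofCoeffs c).coeff 0 = c 0 :=
  coeff_ofCoeffs c 0

theorem coeff_last_ofCoeffs : (ofCoeffs c).coeff d = c (Fin.last d) :=
  coeff_ofCoeffs c (Fin.last d)

theorem natDegree_ofCoeffs (hc : c (Fin.last d) ≠ 0) : (ofCoeffs c).natDegree = d := by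
  refine le_antisymm (Polynomial.natDegree_sum_le_of_forall_le _ _ fun i _ => ?_)
    (Polynomial.le_natDegree_of_ne_zero ?_)
  · exact (Polynomial.natDegree_C_mul_X_pow_le _ _).trans i.is_le
  · rwa [coeff_last_ofCoeffs]

theorem isPrimitive_ofCoeffs (c : Fin (d + 1) → ℤ) (hc : Finset.univ.gcd c = 1) :
    (ofCoeffs c).IsPrimitive := fun r hr =>
  isUnit_of_dvd_one (hc ▸ Finset.dvd_gcd fun i _ =>
    coeff_ofCoeffs c i ▸ (Polynomial.C_dvd_iff_dvd_coeff r _).mp hr i)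

end Coefficients

section QuotientMaxFinite

variable {M : Type*} [AddCommGroup M] [Module ℤ[T;T⁻¹] M] [Module.Finite ℤ[T;T⁻¹] M]
  {δ : ℤ[T;T⁻¹]}

theorem IsOrder.exists_isAmalgamDecomposition (hΔ : IsOrder M δ) (hδ : IsPrimitive δ) :
    ∃ (e : ℕ) (f g : (Fin e → ℤ) →+ (Fin e → ℤ)) (β : (Fin e → ℤ) →ₗ[ℤ] M ⧸ maxFinite M),
      IsAmalgamDecomposition f g β := by
  have hprime (p : ℕ) (hp : p.Prime) :
      ∃ a ∈ Module.annihilator ℤ[T;T⁻¹] M, ¬ LaurentPolynomial.C (p : ℤ) ∣ a :=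
    hΔ.exists_mem_annihilator_not_C_dvd hδ (Nat.prime_iff_prime_int.mp hp).not_isUnit
  have := isAddTorsionFree_quotient_maxFinite hprime
  obtain ⟨a, ha, ha2⟩ := hprime 2 Nat.prime_two
  exact LaurentModule.exists_isAmalgamDecomposition (by rintro rfl; exact ha2 (dvd_zero _))
    ((maxFinite M).mkQ.annihilator_le_of_surjective (maxFinite M).mkQ_surjective ha)

theorem IsOrder.associated_det_pencil (hΔ : IsOrder M δ) (hδ : IsPrimitive δ)
    {Z : Submodule ℤ[T;T⁻¹] M} [Finite Z] {d : ℕ} {f g : (Fin d → ℤ) →+ (Fin d → ℤ)}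
    (e : (M ⧸ Z) ≃ₗ[ℤ[T;T⁻¹]] Amalgam f g) : Associated δ (pencil f g).det := by
  obtain ⟨e'⟩ := isPresentationMatrix_pencil f g
  have hdvd (a : ℤ[T;T⁻¹]) : a ∣ δ ↔ a ∣ (pencil f g).det := by
    rw [hΔ.dvd_iff_fittingIdeal_quotient_le hδ Z, fittingIdeal_congr e,
      fittingIdeal_eq_span_det e', det_transpose, Ideal.span_singleton_le_span_singleton]
  exact associated_of_dvd_dvd ((hdvd δ).mp dvd_rfl) ((hdvd _).mpr dvd_rfl)

end QuotientMaxFinite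

end LaurentModule

end

theorem corollary2p4 (M : Type*) [AddCommGroup M] [Module ℤ[T;T⁻¹] M] [Module.Finite ℤ[T;T⁻¹] M]
    (d : ℕ) (c : Fin (d + 1) → ℤ)
    (hΔ : LaurentModule.IsOrder M
      (∑ i : Fin (d + 1), LaurentPolynomial.C (c i) * LaurentPolynomial.T ((i : ℕ) : ℤ)))
    (hc : c 0 * c (Fin.last d) ≠ 0)
    (hgcd : Finset.univ.gcd c = 1) :
    ∃ f g : (Fin d → ℤ) →+ (Fin d → ℤ),
      Function.Injective f ∧ Function.Injective g ∧
      Nonempty ((M ⧸ LaurentModule.maxFinite M) ≃ₗ[ℤ[T;T⁻¹]] LaurentModule.Amalgam f g) ∧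
      Associated
        (∑ i : Fin (d + 1), LaurentPolynomial.C (c i) * LaurentPolynomial.T ((i : ℕ) : ℤ))
        (LaurentModule.pencil f g).det ∧
      (c 0).natAbs = f.range.index ∧
      (c (Fin.last d)).natAbs = g.range.index := by
  open LaurentModule in
  have : Finite (maxFinite M) := (maxFinite_isGreatest M).1
  have hprim := isPrimitive_toLaurent_iff.mpr (isPrimitive_ofCoeffs c hgcd)
  rw [← toLaurent_ofCoeffs] at hΔ ⊢
  obtain ⟨e, f, g, β, h⟩ := hΔ.exists_isAmalgamDecomposition hprim
  have E := (LinearEquiv.ofBijective _ h.lift_bijective).symm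
  have hdet := hΔ.associated_det_pencil hprim E
  have hassoc : Associated (ofCoeffs c) (pencilPolynomial f g) :=
    associated_of_associated_toLaurent (by rw [coeff_zero_ofCoeffs]; exact left_ne_zero_of_mul hc)
      (coeff_zero_pencilPolynomial_ne_zero h.injective_left)
      (by rwa [toLaurent_pencilPolynomial])
  obtain rfl : d = e := by
    rw [← natDegree_ofCoeffs c (right_ne_zero_of_mul hc),
      ← natDegree_pencilPolynomial (f := f) h.injective_right,
      Polynomial.natDegree_eq_of_degree_eq (Polynomial.degree_eq_degree_of_associated hassoc)]
  refine ⟨f, g, h.injective_left, h.injective_right, ⟨E⟩, hdet, ?_, ?_⟩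
  · rw [← natAbs_coeff_zero_pencilPolynomial h.injective_left (g := g),
      ← natAbs_coeff_eq_of_associated hassoc, coeff_zero_ofCoeffs]
  · rw [← natAbs_coeff_pencilPolynomial h.injective_right (f := f),
      ← natAbs_coeff_eq_of_associated hassoc, coeff_last_ofCoeffs]
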